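/- Fix an integer $k \ge 2$. Let $(G_i)_{i\in\mathbb N}$ be a sequence of finite simple graphs, where $G_i$ has $n_i$ vertices and average degree $d_i$, such that no $G_i$ contains a cycle of even length at most $2k$ or a cycle of length at most $k$ (of either parity) as a subgraph (that is, $G_i$ is $(\mathcal C^{\rm even}_{2k}\cup\mathcal C_k)$-free, where $\mathcal C^{\rm even}_{2k}=\{C_4,C_6,\dots,C_{2k}\}$ and $\mathcal C_k=\{C_3,C_4,\dots,C_k\}$). Suppose that $n_i\to\infty$ and $d_i\sim n_i^{1/k}$, i.e. $d_i/n_i^{1/k}\to 1$, as $i\to\infty$. For $S,T\subseteq V(G_i)$, not necessarily disjoint, let $e_{G_i}(S,T)$ be the number of ordered pairs $(s,t)$ with $s\in S$, $t\in T$ and $st\in E(G_i)$. Then $$e_{G_i}(S,T)=\frac{d_i}{n_i}\,|S|\,|T|+o\bigl(n_i^{1+1/k}\bigr)$$ uniformly in $S,T$: there are real numbers $r_i$ with $r_i=o(n_i^{1+1/k})$ as $i\to\infty$ such that $\bigl|e_{G_i}(S,T)-\frac{d_i}{n_i}|S||T|\bigr|\le r_i$ for all $i$ and all $S,T\subseteq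 V(G_i)$ (the term $\frac{d_i}{n_i}|S||T|$ being read as $0$ if $n_i=0$). -/

import Mathlib

/-- The lengths of the cycles in the family `{C_4, C_6, …, C_{2k}}` of all even cycles of length
at most `2k`. -/
def evenCycleLengths (k : ℕ) : Set ℕ := {m | Even m ∧ 4 ≤ m ∧ m ≤ 2 * k}

/-- The lengths of the cycles in the family `{C_3, C_4, …, C_k}` of all cycles of length
at most `k` (this family is empty for `k = 2`). -/
def shortCycleLengths (k : ℕ) : Set ℕ := {m | 3 ≤ m ∧ m ≤ k}

/-- `G` contains no cycle `C_m` with `m ∈ L` as a (not necessarily induced) subgraph. -/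
def IsCycleFamilyFree {V : Type*} (L : Set ℕ) (G : SimpleGraph V) : Prop :=
  ∀ m ∈ L, (SimpleGraph.cycleGraph m).Free G

/-- The average degree of a finite graph. -/
noncomputable def averageDegree {V : Type*} [Fintype V] (G : SimpleGraph V)
    [DecidableRel G.Adj] : ℝ :=
  (∑ v, (G.degree v : ℝ)) / (Fintype.card V : ℝ)

/-- `e_G(S, T)`: the number of ordered pairs `(s, t)` with `s ∈ S`, `t ∈ T` and `st` an edge. -/
def edgesBetween {V : Type*} (G : SimpleGraph V) [DecidableRel G.Adj] (S T : Finset V) : ℕ :=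
  (G.interedges S T).card

/-!
Write `n`, `c` and `A` for the number of vertices, the average degree and the adjacency matrix of a
graph without the forbidden cycles.

Two vertices are joined by at most one path of length `k`
(`SimpleGraph.Walk.IsPath.eq_of_length_eq`), and a nonbacktracking walk of length `k` is a path
(`SimpleGraph.Walk.isPath_of_isNonbacktracking`). Hence there are at most `n ^ 2` nonbacktracking
walks of length `k`, while a regular graph of degree `c` has about `n * c ^ k ~ n ^ 2` of them. The
hypothesis is thus extremal, and near equality forces regularity and quasirandomness.

Regularity: give a walk the weight `∏ (c / deg v)` over its inner vertices `v`. These weights are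
those of a stationary random walk, so all sums with them can be computed, and the backtracking walks
have negligible total weight. The inequality `1 ≥ ∏ gᵢ * (1 + ∑ 2 * (1 - √gᵢ))`
(`innerWeight_mul_le_one`) summed over the nonbacktracking walks yields
`n ^ 2 ≥ n * c ^ k + (k - 1) * c ^ (k - 1) * ∑ v, (√(deg v) - √c) ^ 2 - O(n * c ^ (k - 1))`
(`le_sum_pathIndicator`), so the degrees are concentrated around `c` (`sum_abs_degree_sub_le`). In
particular deleting all edges at vertices of degree above `2 * c` loses only `o(n * c)` edges, and the
same inequality shows that the remaining graph still has `n ^ 2 - o(n ^ 2)` pairs joined by a path of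
length `k`.

Quasirandomness: in the remaining graph `A ^ k = J - E + B`, where `J` is the all-ones matrix, `E` is
the 0/1 matrix of the pairs not joined by a path of length `k`, with `o(n ^ 2)` ones, and `B` counts
the backtracking walks, with row sums `O(c ^ (k - 1)) = o(n)`. For `x` orthogonal to the constants
this gives `‖A ^ k x‖ = o(n) * ‖x‖`, and log-convexity of `j ↦ ‖A ^ j x‖` gives
`‖A x‖ = o(n ^ (1 / k)) * ‖x‖` (`pow_succ_mulVec_dotProduct_le_of_near_one`). Applying this to the
centred indicator function of `S` and pairing with that of `T` gives the estimate
(`edgesBetween_sub_pow_le`, `abs_edgesBetween_sub_le`).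

In the lemmas that involve walks the length is written as `k + 1`.
-/

/-! ### Paths in graphs without short cycles -/

section Paths

open SimpleGraph

variable {V : Type*} {G : SimpleGraph V}

/-- Freeness of a family of cycles passes to subgraphs. -/
theorem IsCycleFamilyFree.mono {L : Set ℕ} {H : SimpleGraph V} (h : H ≤ G)
    (hG : IsCycleFamilyFree L G) : IsCycleFamilyFree L H :=
  fun m hm hc => hG m hm (hc.mono_right h)

theorem IsCycleFamilyFree.length_notMem {L : Set ℕ} (hG : IsCycleFamilyFree L G) {v : V}
    {p : G.Walk v v} (hp : p.IsCycle) : p.length ∉ L := by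
  intro hL
  have h3 := hp.three_le_length
  exact hG _ hL ((cycleGraph_isContained_iff (by omega)).2 ⟨v, p, hp, rfl⟩)

theorem lt_length_of_isCycle {k : ℕ}
    (hG : IsCycleFamilyFree (evenCycleLengths k ∪ shortCycleLengths k) G) {v : V}
    {p : G.Walk v v} (hp : p.IsCycle) : k < p.length := by
  by_contra! h
  exact hG.length_notMem hp (Or.inr ⟨hp.three_le_length, h⟩)

/-- Two distinct paths with the same end points have total length greater than `k`, as they
contain a cycle. -/
theorem lt_length_add_length {k : ℕ}
    (hG : IsCycleFamilyFree (evenCycleLengths k ∪ shortCycleLengths k) G) {u v : V}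
    {p q : G.Walk u v} (hp : p.IsPath) (hq : q.IsPath) (hne : p ≠ q) :
    k < p.length + q.length := by
  obtain ⟨w, -, -, c, hc, hle⟩ := hp.exists_isCycle_length_le_add_of_ne hq hne
  exact (lt_length_of_isCycle hG hc).trans_le hle

/-- Between two vertices there is at most one path of each length `m ≤ k`. Two such paths without
a common inner vertex form the cycle `C_{2m}`. If they meet at `w` after equally many steps, both
halves agree by induction; otherwise both halves are pairs of distinct paths, and the two cycles
they contain cannot both be longer than `k`. -/
theorem SimpleGraph.Walk.IsPath.eq_of_length_eq {k : ℕ}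
    (hG : IsCycleFamilyFree (evenCycleLengths k ∪ shortCycleLengths k) G) {u v : V}
    {p q : G.Walk u v} (hp : p.IsPath) (hq : q.IsPath) (hpk : p.length ≤ k)
    (hpq : p.length = q.length) : p = q := by
  classical
  induction hs : p.length using Nat.strongRec generalizing u v with | ind s ih =>
  by_contra hne
  by_cases! hw : ∃ w, w ∈ p.support ∧ w ∈ q.support ∧ w ≠ u ∧ w ≠ v
  · obtain ⟨w, hwp, hwq, hwu, hwv⟩ := hw
    have lp : (p.takeUntil w hwp).length + (p.dropUntil w hwp).length = p.length := by
      rw [← Walk.length_append, Walk.take_spec]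
    have lq : (q.takeUntil w hwq).length + (q.dropUntil w hwq).length = q.length := by
      rw [← Walk.length_append, Walk.take_spec]
    have l1 := Walk.length_takeUntil_lt_length hwp hwv
    have l2 := Walk.length_dropUntil_lt_length hwp hwu
    by_cases hl : (p.takeUntil w hwp).length = (q.takeUntil w hwq).length
    · apply hne
      rw [← Walk.take_spec p hwp, ← Walk.take_spec q hwq,
        ih _ (hs ▸ l1) (hp.takeUntil hwp) (hq.takeUntil hwq) (by omega) hl rfl,
        ih _ (hs ▸ l2) (hp.dropUntil hwp) (hq.dropUntil hwq) (by omega) (by omega) rfl]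
    · have h1 := lt_length_add_length hG (hp.takeUntil hwp) (hq.takeUntil hwq)
        (fun h => hl (by rw [h]))
      have h2 := lt_length_add_length hG (hp.dropUntil hwp) (hq.dropUntil hwq)
        (fun h => hl (by have := congrArg Walk.length h; omega))
      omega
  · have hc : (p.append q.reverse).IsCycle := by
      refine hp.isCycle_append (Walk.isPath_reverse_iff q |>.mpr hq) (fun _ ↦ ?_) ?_
      · grind [Walk.dropLast_support_concat, Walk.IsPath.support_nodup, Walk.support_reverse,
          Walk.cons_tail_support]
      · grind [Walk.length_reverse, Walk.eq_of_length_le_one]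
    have hlen : (p.append q.reverse).length = 2 * p.length := by
      rw [Walk.length_append, Walk.length_reverse]; omega
    have h3 := hc.three_le_length
    exact hG.length_notMem hc (Or.inl ⟨⟨p.length, by omega⟩, by omega, by omega⟩)

/-- A list of vertices that never returns to a vertex two steps after leaving it. -/
def IsNonbacktracking : List V → Prop
  | a :: b :: c :: l => a ≠ c ∧ IsNonbacktracking (b :: c :: l)
  | _ => True

theorem IsNonbacktracking.tail {a : V} {l : List V} (h : IsNonbacktracking (a :: l)) :
    IsNonbacktracking l := by
  match l, h with
  | [], _ => trivial
  | [_], _ => trivial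
  | _ :: _ :: _, h => exact h.2

/-- Without cycles of length at most `k`, a nonbacktracking walk of length at most `k` is a path:
a first return would close up a short cycle. -/
theorem SimpleGraph.Walk.isPath_of_isNonbacktracking {k : ℕ}
    (hG : IsCycleFamilyFree (evenCycleLengths k ∪ shortCycleLengths k) G) {u v : V}
    (p : G.Walk u v) (hpk : p.length ≤ k) (hp : IsNonbacktracking p.support) : p.IsPath := by
  classical
  induction p with
  | nil => exact .nil
  | @cons u w v h p ih =>
    rw [Walk.length_cons] at hpk
    have hpp : p.IsPath := ih (by omega) hp.tail
    refine Walk.cons_isPath_iff h p |>.2 ⟨hpp, fun hu => ?_⟩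
    have hc : (Walk.cons h (p.takeUntil u hu)).IsCycle := by
      refine (Walk.cons_isCycle_iff _ h).2 ⟨hpp.takeUntil hu, fun he => ?_⟩
      -- a path from `w` that uses the edge `uw` starts with it, so the walk backtracks
      have he' := Walk.edges_takeUntil_subset_edges p hu he
      cases p with
      | nil => simp at he'
      | @cons _ x _ h' p' =>
        have hux : u ≠ x := by
          rw [Walk.support_cons, Walk.support_cons] at hp
          rw [← Walk.cons_tail_support p'] at hp
          exact hp.1
        rw [Walk.edges_cons, List.mem_cons] at he'
        rcases he' with he' | he'
        · rw [Sym2.eq_iff] at he'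
          rcases he' with ⟨h1, -⟩ | ⟨h1, -⟩
          · exact h.ne h1
          · exact hux h1
        · exact ((Walk.cons_isPath_iff h' p').1 hpp).2 (p'.snd_mem_support_of_mem_edges he')
    have h1 := lt_length_of_isCycle hG hc
    have h2 := Walk.length_takeUntil_le_length p hu
    rw [Walk.length_cons] at h1
    omega

/-- A path does not backtrack. -/
theorem SimpleGraph.Walk.IsPath.isNonbacktracking_support {u v : V} {p : G.Walk u v} (hp : p.IsPath) :
    IsNonbacktracking p.support := by
  have key : ∀ l : List V, l.Nodup → IsNonbacktracking l := by
    intro l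
    induction l with
    | nil => exact fun _ => trivial
    | cons a l ih =>
      intro h
      match l, ih, h with
      | [], _, _ => trivial
      | [_], _, _ => trivial
      | b :: c :: l, ih, h => exact ⟨by simp at h; tauto, ih h.tail⟩
  exact key _ hp.support_nodup

theorem getLast?_support {u v : V} (p : G.Walk u v) : p.support.getLast? = some v := by
  rw [List.getLast?_eq_getLast_of_ne_nil p.support_ne_nil, Walk.getLast_support]

/-- The indicator of the pairs of vertices joined by a path of length `k`. -/
noncomputable def pathIndicator (G : SimpleGraph V) (k : ℕ) (u v : V) : ℝ :=
  open Classical in if ∃ p : G.Walk u v, p.IsPath ∧ p.length = k then 1 else 0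

theorem pathIndicator_comm (k : ℕ) (u v : V) : pathIndicator G k u v = pathIndicator G k v u := by
  unfold pathIndicator
  congr 1
  rw [eq_iff_iff]
  constructor <;> rintro ⟨p, hp, hk⟩ <;>
    exact ⟨p.reverse, hp.reverse, by rw [Walk.length_reverse, hk]⟩

theorem pathIndicator_eq_zero_or_one (k : ℕ) (u v : V) :
    pathIndicator G k u v = 0 ∨ pathIndicator G k u v = 1 := by
  unfold pathIndicator
  split_ifs <;> simp

end Paths

/-! ### Summing over walks -/

section Walks

open SimpleGraph Finset

variable {V : Type*} [Fintype V] {G : SimpleGraph V} [DecidableRel G.Adj]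

/-- Summing a function of the endpoint over all directed edges. -/
theorem sum_sum_neighborFinset (f : V → ℝ) :
    ∑ u, ∑ v ∈ G.neighborFinset u, f v = ∑ v, G.degree v * f v := by
  rw [sum_comm' (t' := univ) (s' := fun v => G.neighborFinset v)]
  · simp
  · simp [adj_comm]

variable [DecidableEq V] (G)

/-- The walks of length `k` that start at `u`, encoded by the lists of their `k + 1` vertices. -/
def walksFrom : ℕ → V → Finset (List V)
  | 0, u => {[u]}
  | k + 1, u => (G.neighborFinset u).biUnion fun v => (walksFrom k v).image (List.cons u)

variable {G}

theorem exists_cons_of_mem_walksFrom {k : ℕ} {u : V} {l : List V} (h : l ∈ walksFrom G k u) :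
    ∃ l', l = u :: l' ∧ l'.length = k := by
  induction k generalizing u l with
  | zero => exact ⟨[], by simpa [walksFrom] using h⟩
  | succ k ih =>
    simp only [walksFrom, mem_biUnion, mem_image] at h
    obtain ⟨v, -, l', hl', rfl⟩ := h
    obtain ⟨l'', rfl, rfl⟩ := ih hl'
    exact ⟨_, rfl, by simp⟩

theorem exists_walk_of_mem_walksFrom {k : ℕ} {u : V} {l : List V} (h : l ∈ walksFrom G k u) :
    ∃ (v : V) (p : G.Walk u v), p.length = k ∧ p.support = l := by
  induction k generalizing u l with
  | zero => exact ⟨u, Walk.nil, rfl, by simpa [walksFrom, eq_comm] using h⟩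
  | succ k ih =>
    simp only [walksFrom, mem_biUnion, mem_image, mem_neighborFinset] at h
    obtain ⟨w, hw, l', hl', rfl⟩ := h
    obtain ⟨v, p, rfl, rfl⟩ := ih hl'
    exact ⟨v, Walk.cons hw p, by simp, by simp⟩

theorem support_mem_walksFrom {u v : V} (p : G.Walk u v) :
    p.support ∈ walksFrom G p.length u := by
  induction p with
  | nil => simp [walksFrom]
  | cons h p ih =>
    simp only [Walk.length_cons, walksFrom, mem_biUnion, mem_image, mem_neighborFinset]
    exact ⟨_, h, _, ih, by simp⟩

theorem sum_walksFrom_succ (k : ℕ) (u : V) (F : List V → ℝ) :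
    ∑ l ∈ walksFrom G (k + 1) u, F l =
      ∑ v ∈ G.neighborFinset u, ∑ l ∈ walksFrom G k v, F (u :: l) := by
  rw [walksFrom, sum_biUnion]
  · refine sum_congr rfl fun v _ => ?_
    rw [sum_image]
    intro a _ b _ h
    exact (List.cons.inj h).2
  · intro v _ w _ hvw
    rw [Function.onFun, Finset.disjoint_left]
    intro l hl hl'
    simp only [mem_image] at hl hl'
    obtain ⟨a, ha, rfl⟩ := hl
    obtain ⟨b, hb, hab⟩ := hl'
    obtain rfl := (List.cons.inj hab).2
    obtain ⟨_, h1, -⟩ := exists_cons_of_mem_walksFrom ha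
    obtain ⟨_, h2, -⟩ := exists_cons_of_mem_walksFrom hb
    rw [h1] at h2
    exact hvw (List.cons.inj h2).1

open Classical in
/-- The walks of length `k + 2` that backtrack do so in their first two steps, or in the walk that
remains after the first step. -/
theorem sum_backtracking_le (k : ℕ) (u : V) (F : List V → ℝ) (hF : ∀ l, 0 ≤ F l) :
    ∑ l ∈ walksFrom G (k + 2) u with ¬ IsNonbacktracking l, F l ≤
      ∑ v ∈ G.neighborFinset u, (∑ l ∈ walksFrom G k u, F (u :: v :: l) +
        ∑ l ∈ walksFrom G (k + 1) v with ¬ IsNonbacktracking l, F (u :: l)) := by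
  rw [sum_filter, sum_walksFrom_succ]
  refine sum_le_sum fun v hv => ?_
  have h1 : ∀ l ∈ walksFrom G (k + 1) v,
      (if ¬ IsNonbacktracking (u :: l) then F (u :: l) else 0) ≤
        (if l[1]? = some u then F (u :: l) else 0) +
          (if ¬ IsNonbacktracking l then F (u :: l) else 0) := by
    intro l hl
    obtain ⟨l', rfl, hlen⟩ := exists_cons_of_mem_walksFrom hl
    obtain _ | ⟨c, l'⟩ := l'
    · simp at hlen
    have := hF (u :: v :: c :: l')
    by_cases hc : c = u
    · subst hc
      simp only [List.getElem?_cons_succ, List.getElem?_cons_zero, if_true]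
      split_ifs <;> simp [this]
    · have : IsNonbacktracking (u :: v :: c :: l') ↔ IsNonbacktracking (v :: c :: l') :=
        ⟨fun h => h.tail, fun h => ⟨fun h => hc h.symm, h⟩⟩
      rw [this]
      simp [hc]
  refine (sum_le_sum h1).trans ?_
  rw [sum_add_distrib, sum_filter]
  refine add_le_add_left (le_of_eq ?_) _
  rw [sum_walksFrom_succ, sum_eq_single_of_mem u]
  · refine sum_congr rfl fun l hl => ?_
    obtain ⟨l', rfl, -⟩ := exists_cons_of_mem_walksFrom hl
    simp
  · rwa [mem_neighborFinset, adj_comm, ← mem_neighborFinset]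
  · intro w _ hw
    refine sum_eq_zero fun l hl => ?_
    obtain ⟨l', rfl, -⟩ := exists_cons_of_mem_walksFrom hl
    simp [hw]

/-- The entries of the powers of the adjacency matrix count walks. -/
theorem adjMatrix_pow_apply_eq_sum_walksFrom (k : ℕ) (u v : V) :
    (G.adjMatrix ℝ ^ k) u v = ∑ l ∈ walksFrom G k u, if l.getLast? = some v then 1 else 0 := by
  induction k generalizing u with
  | zero => rw [walksFrom, sum_singleton]; simp [Matrix.one_apply]
  | succ k ih =>
    rw [pow_succ', adjMatrix_mul_apply, sum_walksFrom_succ]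
    refine sum_congr rfl fun w _ => ?_
    rw [ih]
    refine sum_congr rfl fun l hl => ?_
    obtain ⟨l', rfl, -⟩ := exists_cons_of_mem_walksFrom hl
    simp [List.getLast?_cons_cons]

theorem sum_getLast?_eq {k : ℕ} {u : V} {l : List V} (h : l ∈ walksFrom G k u) :
    ∑ v : V, (if l.getLast? = some v then (1 : ℝ) else 0) = 1 := by
  obtain ⟨v, p, -, rfl⟩ := exists_walk_of_mem_walksFrom h
  simp [getLast?_support]

/-- If all degrees are at most `D`, at most `D ^ k` walks of length `k` start at any vertex. -/
theorem card_walksFrom_le {D : ℝ} (hD : ∀ v, (G.degree v : ℝ) ≤ D) (k : ℕ) (u : V) :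
    ∑ _l ∈ walksFrom G k u, (1 : ℝ) ≤ D ^ k := by
  have hD0 : 0 ≤ D := (Nat.cast_nonneg _).trans (hD u)
  induction k generalizing u with
  | zero => simp [walksFrom]
  | succ k ih =>
    rw [sum_walksFrom_succ, pow_succ']
    refine (sum_le_sum fun v _ => ih v).trans ?_
    rw [sum_const, card_neighborFinset_eq_degree, nsmul_eq_mul]
    gcongr
    exact hD u

open Classical in
/-- If all degrees are at most `D`, at most `k * D ^ k` walks of length `k + 1` from a given vertex
backtrack: each backtracking step leaves no choice. -/
theorem card_backtracking_le {D : ℝ} (hD : ∀ v, (G.degree v : ℝ) ≤ D) (k : ℕ) (u : V) :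
    ∑ _l ∈ walksFrom G (k + 1) u with ¬ IsNonbacktracking _l, (1 : ℝ) ≤ k * D ^ k := by
  have hD0 : 0 ≤ D := (Nat.cast_nonneg _).trans (hD u)
  induction k generalizing u with
  | zero =>
    rw [sum_filter, sum_walksFrom_succ]
    simp [walksFrom, IsNonbacktracking]
  | succ k ih =>
    refine (sum_backtracking_le k u (fun _ => 1) fun _ => zero_le_one).trans ?_
    refine (sum_le_sum fun v _ => add_le_add (card_walksFrom_le hD k u) (ih v)).trans ?_
    rw [sum_const, card_neighborFinset_eq_degree, nsmul_eq_mul]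
    calc (G.degree u : ℝ) * (D ^ k + k * D ^ k) ≤ D * (D ^ k + k * D ^ k) := by
          gcongr
          exact hD u
      _ = _ := by push_cast; ring

open Classical in
/-- In a graph of the family, `pathIndicator` counts the nonbacktracking walks of length `k`
between two vertices. -/
theorem sum_nonbacktracking_eq_pathIndicator {k : ℕ}
    (hG : IsCycleFamilyFree (evenCycleLengths k ∪ shortCycleLengths k) G) (u v : V) :
    ∑ l ∈ walksFrom G k u with IsNonbacktracking l,
      (if l.getLast? = some v then (1 : ℝ) else 0) = pathIndicator G k u v := by
  rw [← sum_filter, filter_filter, sum_const, nsmul_one]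
  have key : ∀ l ∈ {l ∈ walksFrom G k u | IsNonbacktracking l ∧ l.getLast? = some v},
      ∃ p : G.Walk u v, p.IsPath ∧ p.length = k ∧ p.support = l := by
    intro l hl
    rw [mem_filter] at hl
    obtain ⟨h1, h2, h3⟩ := hl
    obtain ⟨w, p, hp, rfl⟩ := exists_walk_of_mem_walksFrom h1
    rw [getLast?_support, Option.some_inj] at h3
    subst h3
    exact ⟨p, p.isPath_of_isNonbacktracking hG hp.le h2, hp, rfl⟩
  unfold pathIndicator
  split_ifs with h
  · obtain ⟨p, hp, hk⟩ := h
    rw [Nat.cast_eq_one, card_eq_one]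
    refine ⟨p.support, ?_⟩
    rw [eq_singleton_iff_unique_mem]
    refine ⟨?_, fun l hl => ?_⟩
    · rw [mem_filter]
      exact ⟨hk ▸ support_mem_walksFrom p, hp.isNonbacktracking_support, getLast?_support p⟩
    · obtain ⟨q, hq, hqk, rfl⟩ := key l hl
      rw [hq.eq_of_length_eq hG hp hqk.le (hqk.trans hk.symm)]
  · rw [Nat.cast_eq_zero, card_eq_zero, eq_empty_iff_forall_notMem]
    intro l hl
    obtain ⟨q, hq, hqk, -⟩ := key l hl
    exact h ⟨q, hq, hqk⟩

open Classical in
theorem sum_nonbacktracking_eq_sum_pathIndicator {k : ℕ}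
    (hG : IsCycleFamilyFree (evenCycleLengths k ∪ shortCycleLengths k) G) (u : V) :
    ∑ _l ∈ walksFrom G k u with IsNonbacktracking _l, (1 : ℝ) = ∑ v, pathIndicator G k u v := by
  simp_rw [← sum_nonbacktracking_eq_pathIndicator hG]
  rw [sum_comm]
  exact sum_congr rfl fun l hl => (sum_getLast?_eq (mem_filter.1 hl).1).symm

open Classical in
theorem adjMatrix_pow_sub_pathIndicator {k : ℕ}
    (hG : IsCycleFamilyFree (evenCycleLengths k ∪ shortCycleLengths k) G) (u v : V) :
    (G.adjMatrix ℝ ^ k) u v - pathIndicator G k u v =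
      ∑ l ∈ walksFrom G k u with ¬ IsNonbacktracking l,
        (if l.getLast? = some v then (1 : ℝ) else 0) := by
  rw [adjMatrix_pow_apply_eq_sum_walksFrom, ← sum_nonbacktracking_eq_pathIndicator hG,
    sub_eq_iff_eq_add', sum_filter_add_sum_filter_not]

end Walks

/-! ### Weighted walks and the concentration of the degrees -/

section Weights

open SimpleGraph Finset

variable {V : Type*}

/-- The product of `g` over the inner vertices of a walk. -/
def innerWeight (g : V → ℝ) (l : List V) : ℝ := (l.tail.dropLast.map g).prod

theorem innerWeight_nonneg {g : V → ℝ} (hg : ∀ v, 0 ≤ g v) (l : List V) : 0 ≤ innerWeight g l :=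
  List.prod_nonneg fun x hx => by
    obtain ⟨v, -, rfl⟩ := List.mem_map.1 hx
    exact hg v

/-- The inequality `∏ gᵢ * (1 + ∑ φᵢ) ≤ 1` for `φᵢ = 2 * (1 - √gᵢ)`, which follows from
`1 + s ≤ exp s` and `√gᵢ ≤ exp (√gᵢ - 1)`. -/
theorem innerWeight_mul_le_one {g : V → ℝ} (hg : ∀ v, 0 ≤ g v) (l : List V) :
    innerWeight g l * (1 + (l.tail.dropLast.map fun v => 2 * (1 - √(g v))).sum) ≤ 1 := by
  have key : ∀ m : List V,
      (m.map g).prod * Real.exp (m.map fun v => 2 * (1 - √(g v))).sum ≤ 1 := by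
    intro m
    induction m with
    | nil => simp
    | cons a m ih =>
      have h0 : 0 ≤ (m.map g).prod := List.prod_nonneg fun x hx => by
        obtain ⟨v, -, rfl⟩ := List.mem_map.1 hx
        exact hg v
      have h1 : g a * Real.exp (2 * (1 - √(g a))) ≤ 1 := by
        have h2 : √(g a) * Real.exp (1 - √(g a)) ≤ 1 := by
          have h3 := Real.add_one_le_exp (√(g a) - 1)
          calc √(g a) * Real.exp (1 - √(g a))
              ≤ Real.exp (√(g a) - 1) * Real.exp (1 - √(g a)) := by gcongr; linarith
            _ = 1 := by rw [← Real.exp_add]; simp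
        calc g a * Real.exp (2 * (1 - √(g a))) = (√(g a) * Real.exp (1 - √(g a))) ^ 2 := by
              rw [mul_pow, Real.sq_sqrt (hg a), ← Real.exp_nat_mul]; norm_num
          _ ≤ 1 := pow_le_one₀ (by positivity) h2
      rw [List.map_cons, List.prod_cons, List.map_cons, List.sum_cons, Real.exp_add]
      calc _ = (g a * Real.exp (2 * (1 - √(g a)))) *
            ((m.map g).prod * Real.exp (m.map fun v => 2 * (1 - √(g v))).sum) := by ring
        _ ≤ 1 * 1 := by
            apply mul_le_mul h1 ih (by positivity) zero_le_one
        _ = 1 := one_mul 1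
  refine le_trans ?_ (key l.tail.dropLast)
  refine mul_le_mul_of_nonneg_left ?_ (innerWeight_nonneg hg l)
  rw [add_comm]
  exact Real.add_one_le_exp _

variable [Fintype V]

theorem sum_pathIndicator_le (G : SimpleGraph V) (k : ℕ) :
    ∑ u, ∑ v, pathIndicator G k u v ≤ (Fintype.card V : ℝ) ^ 2 := by
  calc ∑ u, ∑ v, pathIndicator G k u v ≤ ∑ _u : V, ∑ _v : V, (1 : ℝ) :=
        sum_le_sum fun u _ => sum_le_sum fun v _ => by
          rcases pathIndicator_eq_zero_or_one k u v with h | h <;> rw [h]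
          exact zero_le_one
    _ = _ := by simp [sq]

variable {G : SimpleGraph V} [DecidableRel G.Adj]

theorem sum_degree_eq : ∑ v, (G.degree v : ℝ) = Fintype.card V * averageDegree G := by
  unfold averageDegree
  cases isEmpty_or_nonempty V
  · simp
  · field_simp

theorem averageDegree_nonneg : 0 ≤ averageDegree G := by
  unfold averageDegree
  positivity

theorem sum_sqrt_degree_sub_sq :
    ∑ v, (√(G.degree v : ℝ) - √(averageDegree G)) ^ 2 =
      ∑ v, (G.degree v : ℝ) * (2 * (1 - √(averageDegree G / G.degree v))) := by
  have h1 : ∀ v, (√(G.degree v : ℝ) - √(averageDegree G)) ^ 2 =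
      G.degree v * (2 * (1 - √(averageDegree G / G.degree v))) +
        (averageDegree G - G.degree v) := by
    intro v
    rw [sub_sq, Real.sq_sqrt (Nat.cast_nonneg _), Real.sq_sqrt averageDegree_nonneg]
    have : (G.degree v : ℝ) * √(averageDegree G / G.degree v) =
        √(G.degree v : ℝ) * √(averageDegree G) := by
      rw [Real.sqrt_div averageDegree_nonneg]
      by_cases hv : G.degree v = 0
      · simp [hv]
      · have h2 : √(G.degree v : ℝ) ≠ 0 := by
          rw [Real.sqrt_ne_zero']
          exact_mod_cast Nat.pos_of_ne_zero hv
        rw [mul_div_assoc', div_eq_iff h2]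
        nth_rewrite 1 [← Real.mul_self_sqrt (Nat.cast_nonneg (G.degree v))]
        ring
    linear_combination 2 * this
  rw [sum_congr rfl fun v _ => h1 v, sum_add_distrib, sum_sub_distrib, sum_degree_eq]
  simp

variable [DecidableEq V]

theorem inner_cons_of_mem_walksFrom {k : ℕ} {v : V} {l : List V}
    (h : l ∈ walksFrom G (k + 1) v) (u : V) :
    (u :: l).tail.dropLast = v :: l.tail.dropLast := by
  obtain ⟨l', rfl, hl⟩ := exists_cons_of_mem_walksFrom h
  obtain _ | ⟨w, l'⟩ := l'
  · simp at hl
  · simp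

theorem innerWeight_cons {k : ℕ} {v : V} {l : List V}
    (h : l ∈ walksFrom G (k + 1) v) (u : V) (g : V → ℝ) :
    innerWeight g (u :: l) = g v * innerWeight g l := by
  rw [innerWeight, inner_cons_of_mem_walksFrom h, List.map_cons, List.prod_cons, innerWeight]

theorem sum_walksFrom_eq_zero {v : V} (hv : G.degree v = 0) (k : ℕ) (F : List V → ℝ) :
    ∑ l ∈ walksFrom G (k + 1) v, F l = 0 := by
  rw [sum_walksFrom_succ, card_eq_zero.1 ((G.card_neighborFinset_eq_degree v).trans hv), sum_empty]

theorem sum_innerWeight (c : ℝ) (k : ℕ) (u : V) :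
    ∑ l ∈ walksFrom G (k + 1) u, innerWeight (fun v => c / G.degree v) l =
      c ^ k * G.degree u := by
  induction k generalizing u with
  | zero =>
    simp only [sum_walksFrom_succ]
    simp [walksFrom, innerWeight]
  | succ k ih =>
    rw [sum_walksFrom_succ]
    have : ∀ v ∈ G.neighborFinset u, ∑ l ∈ walksFrom G (k + 1) v,
        innerWeight (fun v => c / (G.degree v : ℝ)) (u :: l) = c ^ (k + 1) := by
      intro v hv
      have hd : (G.degree v : ℝ) ≠ 0 := by
        rw [Nat.cast_ne_zero, ← Nat.pos_iff_ne_zero, degree_pos_iff_exists_adj]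
        exact ⟨u, ((G.mem_neighborFinset u v).1 hv).symm⟩
      rw [sum_congr rfl fun l hl => innerWeight_cons hl u _, ← mul_sum, ih]
      field_simp
      ring
    rw [sum_congr rfl this, sum_const, card_neighborFinset_eq_degree, nsmul_eq_mul, mul_comm]

/-- With the inner weights `c / deg v`, every inner vertex of a weighted walk is distributed
proportionally to the degree. -/
theorem sum_innerWeight_mul_sum (c : ℝ) (φ : V → ℝ) (k : ℕ) :
    ∑ u, ∑ l ∈ walksFrom G (k + 1) u,
      innerWeight (fun v => c / G.degree v) l * (l.tail.dropLast.map φ).sum =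
      k * c ^ k * ∑ v, G.degree v * φ v := by
  induction k with
  | zero =>
    simp only [sum_walksFrom_succ]
    simp [walksFrom]
  | succ k ih =>
    have h1 : ∀ u, ∑ l ∈ walksFrom G (k + 1 + 1) u,
        innerWeight (fun v => c / (G.degree v : ℝ)) l * (l.tail.dropLast.map φ).sum =
        ∑ v ∈ G.neighborFinset u, c / (G.degree v : ℝ) * (φ v * (c ^ k * G.degree v) +
          ∑ l ∈ walksFrom G (k + 1) v,
            innerWeight (fun v => c / (G.degree v : ℝ)) l * (l.tail.dropLast.map φ).sum) := by
      intro u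
      rw [sum_walksFrom_succ]
      refine sum_congr rfl fun v _ => ?_
      rw [← sum_innerWeight, mul_sum, ← sum_add_distrib, mul_sum]
      refine sum_congr rfl fun l hl => ?_
      rw [innerWeight_cons hl, inner_cons_of_mem_walksFrom hl, List.map_cons, List.sum_cons]
      ring
    rw [sum_congr rfl fun u _ => h1 u, sum_sum_neighborFinset]
    have h2 : ∀ v, (G.degree v : ℝ) * (c / (G.degree v : ℝ) * (φ v * (c ^ k * G.degree v) +
          ∑ l ∈ walksFrom G (k + 1) v,
            innerWeight (fun v => c / (G.degree v : ℝ)) l * (l.tail.dropLast.map φ).sum)) =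
        c ^ (k + 1) * (G.degree v * φ v) + c * ∑ l ∈ walksFrom G (k + 1) v,
            innerWeight (fun v => c / (G.degree v : ℝ)) l * (l.tail.dropLast.map φ).sum := by
      intro v
      by_cases hv : G.degree v = 0
      · rw [sum_walksFrom_eq_zero hv]
        simp [hv]
      · have : (G.degree v : ℝ) ≠ 0 := by exact_mod_cast hv
        field_simp
        ring
    rw [sum_congr rfl fun v _ => h2 v, sum_add_distrib, ← mul_sum, ← mul_sum, ih]
    push_cast
    ring

open Classical in
/-- The backtracking walks carry little weight. -/
theorem sum_innerWeight_backtracking_le {c : ℝ} (hc : 0 ≤ c) (k : ℕ) :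
    ∑ u, ∑ l ∈ walksFrom G (k + 1) u with ¬ IsNonbacktracking l,
      innerWeight (fun v => c / G.degree v) l ≤ k * (Fintype.card V * c ^ k) := by
  have hg : ∀ v, 0 ≤ c / (G.degree v : ℝ) := fun v => by positivity
  induction k with
  | zero =>
    refine le_of_eq ?_
    simp only [sum_filter, sum_walksFrom_succ]
    simp [walksFrom, IsNonbacktracking]
  | succ k ih =>
    have h1 : ∀ u, ∑ l ∈ walksFrom G (k + 1 + 1) u with ¬ IsNonbacktracking l,
        innerWeight (fun v => c / (G.degree v : ℝ)) l ≤
        ∑ v ∈ G.neighborFinset u, c / (G.degree v : ℝ) * (c ^ k +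
          ∑ l ∈ walksFrom G (k + 1) v with ¬ IsNonbacktracking l,
            innerWeight (fun v => c / (G.degree v : ℝ)) l) := by
      intro u
      refine (sum_backtracking_le k u _ (innerWeight_nonneg hg)).trans ?_
      refine sum_le_sum fun v hv => ?_
      rw [mul_add]
      refine add_le_add ?_ (le_of_eq ?_)
      · have huv : G.Adj v u := ((G.mem_neighborFinset u v).1 hv).symm
        have hmem : ∀ l ∈ walksFrom G k u, v :: l ∈ walksFrom G (k + 1) v := by
          intro l hl
          rw [walksFrom, mem_biUnion]
          exact ⟨u, (G.mem_neighborFinset v u).2 huv, mem_image_of_mem _ hl⟩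
        rw [sum_congr rfl fun l hl => innerWeight_cons (hmem l hl) u _, ← mul_sum]
        refine mul_le_mul_of_nonneg_left ?_ (hg v)
        cases k with
        | zero => simp [walksFrom, innerWeight]
        | succ k =>
          rw [sum_congr rfl fun l hl => innerWeight_cons hl v _, ← mul_sum, sum_innerWeight]
          have hd : (G.degree u : ℝ) ≠ 0 := by
            rw [Nat.cast_ne_zero, ← Nat.pos_iff_ne_zero, degree_pos_iff_exists_adj]
            exact ⟨v, huv.symm⟩
          refine le_of_eq ?_
          field_simp
          ring
      · rw [mul_sum]
        exact sum_congr rfl fun l hl => innerWeight_cons (mem_filter.1 hl).1 u _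
    refine (sum_le_sum fun u _ => h1 u).trans ?_
    rw [sum_sum_neighborFinset]
    have h2 : ∀ v, (G.degree v : ℝ) * (c / (G.degree v : ℝ) * (c ^ k +
          ∑ l ∈ walksFrom G (k + 1) v with ¬ IsNonbacktracking l,
            innerWeight (fun v => c / (G.degree v : ℝ)) l)) ≤
        c * (c ^ k + ∑ l ∈ walksFrom G (k + 1) v with ¬ IsNonbacktracking l,
            innerWeight (fun v => c / (G.degree v : ℝ)) l) := by
      intro v
      rw [← mul_assoc]
      refine mul_le_mul_of_nonneg_right ?_
        (add_nonneg (by positivity) (sum_nonneg fun l _ => innerWeight_nonneg hg l))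
      by_cases hv : G.degree v = 0
      · simpa [hv] using hc
      · have : (G.degree v : ℝ) ≠ 0 := by exact_mod_cast hv
        rw [mul_div_cancel₀ _ this]
    refine (sum_le_sum fun v _ => h2 v).trans ?_
    rw [← mul_sum, sum_add_distrib, sum_const, card_univ, nsmul_eq_mul]
    calc c * ((Fintype.card V : ℝ) * c ^ k + _) ≤
        c * ((Fintype.card V : ℝ) * c ^ k + k * (Fintype.card V * c ^ k)) := by gcongr
      _ = _ := by push_cast; ring

open Classical in
/-- A lower bound for the number of nonbacktracking walks of length `k + 1`, with a gain measuring
how far the graph is from being regular. -/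
theorem le_card_nonbacktracking (k : ℕ) :
    Fintype.card V * averageDegree G ^ (k + 1) + k * averageDegree G ^ k *
        ∑ v, (√(G.degree v : ℝ) - √(averageDegree G)) ^ 2 -
      (2 * k + 1) * k * (Fintype.card V * averageDegree G ^ k) ≤
    ∑ u, ∑ _l ∈ walksFrom G (k + 1) u with IsNonbacktracking _l, (1 : ℝ) := by
  set c := averageDegree G
  have hc : 0 ≤ c := averageDegree_nonneg
  have hg : ∀ v, 0 ≤ c / (G.degree v : ℝ) := fun v => by positivity
  set g : V → ℝ := fun v => c / (G.degree v : ℝ)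
  set φ : V → ℝ := fun v => 2 * (1 - √(g v))
  have hlen : ∀ u, ∀ l ∈ walksFrom G (k + 1) u, 1 + (l.tail.dropLast.map φ).sum ≤ 2 * k + 1 := by
    intro u l hl
    obtain ⟨l', rfl, hl'⟩ := exists_cons_of_mem_walksFrom hl
    have h := List.sum_le_card_nsmul (l'.dropLast.map φ) 2 (by
      intro x hx
      obtain ⟨v, -, rfl⟩ := List.mem_map.1 hx
      have := Real.sqrt_nonneg (g v)
      simp only [φ]
      linarith)
    rw [List.length_map, List.length_dropLast, hl', Nat.add_sub_cancel, nsmul_eq_mul] at h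
    rw [List.tail_cons]
    linarith
  have hsplit : ∀ u,
      ∑ l ∈ walksFrom G (k + 1) u, innerWeight g l * (1 + (l.tail.dropLast.map φ).sum) ≤
      ∑ _l ∈ walksFrom G (k + 1) u with IsNonbacktracking _l, (1 : ℝ) +
      (2 * k + 1) * ∑ l ∈ walksFrom G (k + 1) u with ¬ IsNonbacktracking l, innerWeight g l := by
    intro u
    rw [← sum_filter_add_sum_filter_not _ IsNonbacktracking]
    refine add_le_add (sum_le_sum fun l _ => innerWeight_mul_le_one hg l) ?_
    rw [mul_sum]
    refine sum_le_sum fun l hl => ?_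
    rw [mul_comm]
    exact mul_le_mul_of_nonneg_right (hlen u l (mem_filter.1 hl).1) (innerWeight_nonneg hg l)
  have htotal := sum_le_sum fun u (_ : u ∈ univ) => hsplit u
  simp only [mul_add, mul_one, sum_add_distrib, ← mul_sum] at htotal
  rw [sum_innerWeight_mul_sum, sum_congr rfl fun u _ => sum_innerWeight c k u, ← mul_sum,
    sum_degree_eq, ← sum_sqrt_degree_sub_sq] at htotal
  have hbt := mul_le_mul_of_nonneg_left (sum_innerWeight_backtracking_le (G := G) hc k)
    (by positivity : (0 : ℝ) ≤ 2 * k + 1)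
  have : c ^ (k + 1) = c ^ k * c := pow_succ _ _
  rw [this]
  linarith

/-- The number of pairs of vertices joined by a path of length `k` is almost as large as in a
regular graph of the same average degree. -/
theorem le_sum_pathIndicator {k : ℕ}
    (hG : IsCycleFamilyFree (evenCycleLengths (k + 1) ∪ shortCycleLengths (k + 1)) G) :
    Fintype.card V * averageDegree G ^ (k + 1) + k * averageDegree G ^ k *
        ∑ v, (√(G.degree v : ℝ) - √(averageDegree G)) ^ 2 -
      (2 * k + 1) * k * (Fintype.card V * averageDegree G ^ k) ≤
    ∑ u, ∑ v, pathIndicator G (k + 1) u v := by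
  classical
  simp_rw [← sum_nonbacktracking_eq_sum_pathIndicator hG]
  exact le_card_nonbacktracking k

/-- The degrees are concentrated in the `L¹` sense. -/
theorem sum_abs_degree_sub_le {k : ℕ} (hk : 1 ≤ k)
    (hG : IsCycleFamilyFree (evenCycleLengths (k + 1) ∪ shortCycleLengths (k + 1)) G)
    (hc : 0 < averageDegree G) {η : ℝ}
    (hη : η = Fintype.card V / averageDegree G ^ (k + 1) - 1 +
      (2 * k + 1) * k * (averageDegree G)⁻¹) :
    ∑ v, |(G.degree v : ℝ) - averageDegree G| ≤ 2 * √η * (Fintype.card V * averageDegree G) := by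
  have h1 := le_sum_pathIndicator hG
  have h2 := sum_pathIndicator_le G (k + 1)
  set c := averageDegree G with hcdef
  set n : ℝ := (Fintype.card V : ℝ)
  set q := ∑ v, (√(G.degree v : ℝ) - √c) ^ 2 with hq
  have hn : 0 ≤ n := Nat.cast_nonneg _
  have hq0 : 0 ≤ q := sum_nonneg fun v _ => sq_nonneg _
  have hqle : q ≤ η * (n * c) := by
    have hk' : (1 : ℝ) ≤ k := by exact_mod_cast hk
    have hck : 0 < c ^ k := by positivity
    have h3 : c ^ k * q ≤ c ^ k * (η * (n * c)) := by
      have e : c ^ k * (η * (n * c)) =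
          n ^ 2 - n * c ^ (k + 1) + (2 * k + 1) * k * (n * c ^ k) := by
        rw [hη, pow_succ]
        field_simp
      rw [e]
      have : c ^ k * q ≤ k * c ^ k * q := by
        rw [mul_assoc]
        exact le_mul_of_one_le_left (by positivity) hk'
      linarith
    exact le_of_mul_le_mul_left h3 hck
  have hp : ∑ v, (√(G.degree v : ℝ) + √c) ^ 2 ≤ 4 * (n * c) := by
    calc ∑ v, (√(G.degree v : ℝ) + √c) ^ 2 ≤ ∑ v, 2 * ((G.degree v : ℝ) + c) := by
          refine sum_le_sum fun v _ => ?_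
          have e1 := Real.sq_sqrt (Nat.cast_nonneg (α := ℝ) (G.degree v))
          have e2 := Real.sq_sqrt hc.le
          nlinarith [sq_nonneg (√(G.degree v : ℝ) - √c)]
      _ = 4 * (n * c) := by
          rw [← mul_sum, sum_add_distrib, sum_degree_eq, sum_const, card_univ, nsmul_eq_mul]
          ring
  have habs : ∀ v, |(G.degree v : ℝ) - c| = |√(G.degree v : ℝ) - √c| * (√(G.degree v : ℝ) + √c) := by
    intro v
    rw [← abs_of_nonneg (by positivity : 0 ≤ √(G.degree v : ℝ) + √c), ← abs_mul]
    congr 1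
    have e1 := Real.sq_sqrt (Nat.cast_nonneg (α := ℝ) (G.degree v))
    have e2 := Real.sq_sqrt hc.le
    linear_combination e2 - e1
  have hcs := sum_mul_sq_le_sq_mul_sq univ (fun v => |√(G.degree v : ℝ) - √c|)
    (fun v => √(G.degree v : ℝ) + √c)
  simp only [sq_abs, ← habs] at hcs
  rw [← hq] at hcs
  by_cases hη0 : 0 ≤ η
  · refine abs_le_of_sq_le_sq' (hcs.trans ?_) (by positivity) |>.2
    calc q * ∑ v, (√(G.degree v : ℝ) + √c) ^ 2 ≤ (η * (n * c)) * (4 * (n * c)) := by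
          gcongr
      _ = (2 * √η * (n * c)) ^ 2 := by
          rw [mul_pow, mul_pow, Real.sq_sqrt hη0]; ring
  · -- for negative `η` both sides vanish, since then `q = 0`
    have hqz : q = 0 := le_antisymm (hqle.trans
      (mul_nonpos_of_nonpos_of_nonneg (le_of_not_ge hη0) (by positivity))) hq0
    rw [hqz, zero_mul] at hcs
    have := pow_eq_zero_iff two_ne_zero |>.1 (le_antisymm hcs (sq_nonneg _))
    rw [this]
    positivity

end Weights

/-! ### The second eigenvalue bound -/

section Spectral

open SimpleGraph Finset Matrix

/-- Log-convexity controls `b 1` by any later term of the sequence. -/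
theorem pow_succ_le_mul_pow_of_sq_le {b : ℕ → ℝ} (hb : ∀ j, 0 ≤ b j)
    (hconv : ∀ j, b (j + 1) ^ 2 ≤ b j * b (j + 2)) (k : ℕ) :
    b 1 ^ (k + 1) ≤ b (k + 1) * b 0 ^ k := by
  have hratio : ∀ j, b 1 * b j ≤ b 0 * b (j + 1) := by
    intro j
    induction j with
    | zero => rw [mul_comm]
    | succ j ih =>
      rcases (hb j).eq_or_lt with h0 | h0
      · have h1 := hconv j
        rw [← h0, zero_mul] at h1
        rw [pow_eq_zero_iff two_ne_zero |>.1 (le_antisymm h1 (sq_nonneg _)), mul_zero]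
        exact mul_nonneg (hb _) (hb _)
      · refine le_of_mul_le_mul_left ?_ h0
        calc b j * (b 1 * b (j + 1)) = (b 1 * b j) * b (j + 1) := by ring
          _ ≤ (b 0 * b (j + 1)) * b (j + 1) := mul_le_mul_of_nonneg_right ih (hb _)
          _ = b 0 * b (j + 1) ^ 2 := by ring
          _ ≤ b 0 * (b j * b (j + 2)) := mul_le_mul_of_nonneg_left (hconv j) (hb 0)
          _ = b j * (b 0 * b (j + 1 + 1)) := by ring
  induction k with
  | zero => simp
  | succ k ih =>
    calc b 1 ^ (k + 1 + 1) = b 1 * b 1 ^ (k + 1) := by ring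
      _ ≤ b 1 * (b (k + 1) * b 0 ^ k) := mul_le_mul_of_nonneg_left ih (hb 1)
      _ = (b 1 * b (k + 1)) * b 0 ^ k := by ring
      _ ≤ (b 0 * b (k + 1 + 1)) * b 0 ^ k :=
          mul_le_mul_of_nonneg_right (hratio _) (pow_nonneg (hb 0) _)
      _ = _ := by ring

variable {V : Type*}

theorem edgesBetween_eq_sum {G : SimpleGraph V} [DecidableRel G.Adj] (S T : Finset V) :
    (edgesBetween G S T : ℝ) = ∑ t ∈ T, ∑ s ∈ S, if G.Adj t s then (1 : ℝ) else 0 := by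
  rw [edgesBetween, interedges_def, card_filter, sum_product_right]
  push_cast
  simp [adj_comm]

variable [Fintype V]

theorem dotProduct_self_nonneg_real (x : V → ℝ) : 0 ≤ x ⬝ᵥ x :=
  sum_nonneg fun v _ => mul_self_nonneg (x v)

theorem dotProduct_sq_le (x y : V → ℝ) : (x ⬝ᵥ y) ^ 2 ≤ (x ⬝ᵥ x) * (y ⬝ᵥ y) := by
  have := sum_mul_sq_le_sq_mul_sq univ x y
  simpa only [dotProduct, sq (x _), sq (y _)] using this

theorem pow_succ_mulVec_dotProduct_le [DecidableEq V] {A : Matrix V V ℝ} (hA : A.IsSymm)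
    (x : V → ℝ) (k : ℕ) :
    ((A *ᵥ x) ⬝ᵥ (A *ᵥ x)) ^ (k + 1) ≤
      ((A ^ (k + 1) *ᵥ x) ⬝ᵥ (A ^ (k + 1) *ᵥ x)) * (x ⬝ᵥ x) ^ k := by
  have h := pow_succ_le_mul_pow_of_sq_le (b := fun j => (A ^ j *ᵥ x) ⬝ᵥ (A ^ j *ᵥ x))
    (fun j => dotProduct_self_nonneg_real _) (fun j => ?_) k
  · simpa using h
  · have e : (A ^ (j + 1) *ᵥ x) ⬝ᵥ (A ^ (j + 1) *ᵥ x) =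
        (A ^ j *ᵥ x) ⬝ᵥ (A ^ (j + 2) *ᵥ x) := by
      rw [pow_succ' A (j + 1), ← mulVec_mulVec _ A,
        dotProduct_mulVec _ A, ← mulVec_transpose A, hA.eq,
        mulVec_mulVec, ← pow_succ']
    rw [e]
    exact dotProduct_sq_le _ _

/-- The Schur test for a nonnegative symmetric matrix. -/
theorem mulVec_dotProduct_le_of_sum_le {B : V → V → ℝ} (hB : ∀ u v, 0 ≤ B u v)
    (hsymm : ∀ u v, B u v = B v u) {β : ℝ} (hβ : ∀ u, ∑ v, B u v ≤ β) (x : V → ℝ) :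
    ∑ u, (∑ v, B u v * x v) ^ 2 ≤ β ^ 2 * (x ⬝ᵥ x) := by
  have h1 : ∀ u, (∑ v, B u v * x v) ^ 2 ≤ β * ∑ v, B u v * x v ^ 2 := by
    intro u
    have h := sum_mul_sq_le_sq_mul_sq univ (fun v => √(B u v)) (fun v => √(B u v) * x v)
    simp only [mul_pow, Real.sq_sqrt (hB _ _), ← mul_assoc, Real.mul_self_sqrt (hB _ _)] at h
    refine h.trans (mul_le_mul_of_nonneg_right (hβ u) ?_)
    exact sum_nonneg fun v _ => mul_nonneg (hB u v) (sq_nonneg _)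
  refine (sum_le_sum fun u _ => h1 u).trans ?_
  rw [← mul_sum, sum_comm, sq, mul_assoc]
  rcases isEmpty_or_nonempty V with hV | ⟨⟨u⟩⟩
  · simp
  have hβ0 : 0 ≤ β := (sum_nonneg fun v _ => hB u v).trans (hβ u)
  refine mul_le_mul_of_nonneg_left ?_ hβ0
  rw [dotProduct, mul_sum]
  refine sum_le_sum fun v _ => ?_
  rw [← sum_mul, ← sq]
  refine mul_le_mul_of_nonneg_right ?_ (sq_nonneg _)
  rw [sum_congr rfl fun u _ => hsymm u v]
  exact hβ v

/-- If `A ^ (k + 1)` differs from the all-ones matrix by a 0/1 matrix `E` of small sum and a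
nonnegative matrix `B` of small row sums, then `A` shrinks the vectors orthogonal to the
constants. -/
theorem pow_succ_mulVec_dotProduct_le_of_near_one [DecidableEq V] {A : Matrix V V ℝ}
    (hA : A.IsSymm) {k : ℕ} {E B : V → V → ℝ} (hAE : ∀ u v, (A ^ (k + 1)) u v = 1 - E u v + B u v)
    (hE : ∀ u v, E u v = 0 ∨ E u v = 1) {e : ℝ} (hsum : ∑ u, ∑ v, E u v ≤ e)
    (hB : ∀ u v, 0 ≤ B u v) (hsymm : ∀ u v, B u v = B v u) {β : ℝ} (hβ : ∀ u, ∑ v, B u v ≤ β)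
    {x : V → ℝ} (hx : ∑ v, x v = 0) :
    ((A *ᵥ x) ⬝ᵥ (A *ᵥ x)) ^ (k + 1) ≤ (2 * β ^ 2 + 2 * e) * (x ⬝ᵥ x) ^ (k + 1) := by
  refine (pow_succ_mulVec_dotProduct_le hA x k).trans ?_
  rw [pow_succ' (x ⬝ᵥ x), ← mul_assoc]
  refine mul_le_mul_of_nonneg_right ?_ (pow_nonneg (dotProduct_self_nonneg_real x) k)
  have h1 : ∀ u, (A ^ (k + 1) *ᵥ x) u = ∑ v, B u v * x v - ∑ v, E u v * x v := by
    intro u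
    have : ∀ v, (A ^ (k + 1)) u v * x v = x v + (B u v * x v - E u v * x v) := fun v => by
      rw [hAE]; ring
    rw [mulVec, dotProduct, sum_congr rfl fun v _ => this v, sum_add_distrib, hx, zero_add,
      sum_sub_distrib]
  have h2 : ∑ u, (∑ v, E u v * x v) ^ 2 ≤ e * (x ⬝ᵥ x) := by
    calc ∑ u, (∑ v, E u v * x v) ^ 2 ≤ ∑ u, (∑ v, E u v) * (x ⬝ᵥ x) := by
          refine sum_le_sum fun u _ => (dotProduct_sq_le (E u) x).trans ?_
          refine mul_le_mul_of_nonneg_right (le_of_eq ?_) (dotProduct_self_nonneg_real x)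
          refine sum_congr rfl fun v _ => ?_
          rcases hE u v with h | h <;> simp [h]
      _ ≤ e * (x ⬝ᵥ x) := by
          rw [← sum_mul]
          exact mul_le_mul_of_nonneg_right hsum (dotProduct_self_nonneg_real x)
  have h3 := mulVec_dotProduct_le_of_sum_le hB hsymm hβ x
  calc (A ^ (k + 1) *ᵥ x) ⬝ᵥ (A ^ (k + 1) *ᵥ x)
      ≤ ∑ u, (2 * (∑ v, B u v * x v) ^ 2 + 2 * (∑ v, E u v * x v) ^ 2) := by
        refine sum_le_sum fun u _ => ?_
        rw [h1]
        nlinarith [sq_nonneg (∑ v, B u v * x v + ∑ v, E u v * x v)]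
    _ ≤ (2 * β ^ 2 + 2 * e) * (x ⬝ᵥ x) := by
        rw [sum_add_distrib, ← mul_sum, ← mul_sum]
        linarith

variable {G : SimpleGraph V} [DecidableRel G.Adj]

variable [DecidableEq V]

/-- Quasirandomness of a graph of the family of maximum degree at most `D`, relative to its own
degrees; the error is governed by the number of pairs not joined by a path of length `k + 1`. -/
theorem edgesBetween_sub_pow_le {k : ℕ}
    (hG : IsCycleFamilyFree (evenCycleLengths (k + 1) ∪ shortCycleLengths (k + 1)) G) {D : ℝ}
    (hD : ∀ v, (G.degree v : ℝ) ≤ D) {e : ℝ}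
    (he : (Fintype.card V : ℝ) ^ 2 - ∑ u, ∑ v, pathIndicator G (k + 1) u v ≤ e) (S T : Finset V) :
    (((edgesBetween G S T : ℝ) - S.card / Fintype.card V * ∑ t ∈ T, (G.degree t : ℝ)) ^ 2) ^ (k + 1)
      ≤ (2 * (k * D ^ k) ^ 2 + 2 * e) * ((Fintype.card V : ℝ) ^ 2) ^ (k + 1) := by
  classical
  rcases isEmpty_or_nonempty V with hV | hV
  · have hS : S = ∅ := Subsingleton.elim _ _
    have hT : T = ∅ := Subsingleton.elim _ _
    simp [edgesBetween_eq_sum, hS, hT]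
  set n : ℝ := (Fintype.card V : ℝ) with hn
  have hn0 : 0 < n := by rw [hn]; exact_mod_cast Fintype.card_pos
  set x : V → ℝ := fun v => (if v ∈ S then 1 else 0) - S.card / n with hxdef
  have hx : ∑ v, x v = 0 := by
    simp only [hxdef, sum_sub_distrib, sum_const, card_univ, nsmul_eq_mul]
    rw [← hn, mul_div_cancel₀ _ hn0.ne']
    simp
  have hSn : (S.card : ℝ) ≤ n := by rw [hn]; exact_mod_cast card_le_univ S
  have hTn : (T.card : ℝ) ≤ n := by rw [hn]; exact_mod_cast card_le_univ T
  have hxx : x ⬝ᵥ x ≤ n := by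
    have h1 : x ⬝ᵥ x = ∑ v, ((if v ∈ S then 1 else 0) - S.card / n * (x v)) -
        S.card / n * ∑ v, (if v ∈ S then (1 : ℝ) else 0) := by
      rw [dotProduct, mul_sum, ← sum_sub_distrib]
      refine sum_congr rfl fun v _ => ?_
      simp only [hxdef]
      split_ifs <;> ring
    rw [h1, sum_sub_distrib, ← mul_sum, hx]
    have h2 : ∑ v, (if v ∈ S then (1 : ℝ) else 0) = S.card := by simp
    rw [h2]
    have : 0 ≤ (S.card : ℝ) / n * S.card := by positivity
    linarith
  set A := G.adjMatrix ℝ with hAdef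
  have key := pow_succ_mulVec_dotProduct_le_of_near_one (A := A) (isSymm_adjMatrix G) (k := k)
    (E := fun u v => 1 - pathIndicator G (k + 1) u v)
    (B := fun u v => (A ^ (k + 1)) u v - pathIndicator G (k + 1) u v)
    (fun u v => by ring)
    (fun u v => by
      rcases pathIndicator_eq_zero_or_one (G := G) (k + 1) u v with h | h <;> simp [h])
    (e := e)
    (by
      simp only [sum_sub_distrib]
      simpa [sq] using he)
    (fun u v => by
      rw [hAdef, adjMatrix_pow_sub_pathIndicator hG]
      exact sum_nonneg fun l _ => by split_ifs <;> simp)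
    (fun u v => by
      rw [pathIndicator_comm, ← ((isSymm_adjMatrix (α := ℝ) G).pow (k + 1)).apply u v])
    (β := k * D ^ k)
    (fun u => by
      simp_rw [hAdef, adjMatrix_pow_sub_pathIndicator hG]
      rw [sum_comm]
      refine le_trans (le_of_eq ?_) (card_backtracking_le hD k u)
      exact sum_congr rfl fun l hl => sum_getLast?_eq (mem_filter.1 hl).1)
    hx
  have hform : (edgesBetween G S T : ℝ) - S.card / n * ∑ t ∈ T, (G.degree t : ℝ) =
      (fun v => if v ∈ T then (1 : ℝ) else 0) ⬝ᵥ (A *ᵥ x) := by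
    have h1 : ∀ t, (A *ᵥ x) t =
        ∑ s ∈ S, (if G.Adj t s then (1 : ℝ) else 0) - S.card / n * G.degree t := by
      intro t
      rw [hAdef, adjMatrix_mulVec_apply]
      simp only [hxdef, sum_sub_distrib, sum_const, card_neighborFinset_eq_degree, nsmul_eq_mul]
      congr 1
      · rw [← sum_filter, ← sum_filter, sum_const, sum_const]
        congr 2
        ext s
        simp [and_comm]
      · ring
    rw [dotProduct]
    simp only [ite_mul, one_mul, zero_mul, h1]
    rw [← sum_filter, filter_mem_eq_inter, univ_inter, sum_sub_distrib, ← mul_sum,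
      edgesBetween_eq_sum]
  have hsq : ((edgesBetween G S T : ℝ) - S.card / n * ∑ t ∈ T, (G.degree t : ℝ)) ^ 2 ≤
      n * ((A *ᵥ x) ⬝ᵥ (A *ᵥ x)) := by
    rw [hform]
    refine (dotProduct_sq_le _ _).trans ?_
    refine mul_le_mul_of_nonneg_right ?_ (dotProduct_self_nonneg_real _)
    simpa [dotProduct] using hTn
  have he0 : 0 ≤ e := (sub_nonneg.2 (sum_pathIndicator_le G (k + 1))).trans he
  calc _ ≤ (n * ((A *ᵥ x) ⬝ᵥ (A *ᵥ x))) ^ (k + 1) := pow_le_pow_left₀ (sq_nonneg _) hsq _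
    _ = n ^ (k + 1) * ((A *ᵥ x) ⬝ᵥ (A *ᵥ x)) ^ (k + 1) := mul_pow _ _ _
    _ ≤ n ^ (k + 1) * ((2 * (k * D ^ k) ^ 2 + 2 * e) * n ^ (k + 1)) := by
        refine mul_le_mul_of_nonneg_left (key.trans ?_) (by positivity)
        have := dotProduct_self_nonneg_real x
        gcongr
    _ = _ := by ring

end Spectral

/-! ### Capping the degrees -/

section Capping

open SimpleGraph Finset

/-- The subgraph of the edges of `G` with both ends in `s`, on the same vertex set. -/
def SimpleGraph.restrictTo {V : Type*} (G : SimpleGraph V) (s : Set V) : SimpleGraph V where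
  Adj u v := G.Adj u v ∧ u ∈ s ∧ v ∈ s
  symm := ⟨fun _ _ h => ⟨h.1.symm, h.2.2, h.2.1⟩⟩
  loopless := ⟨fun _ h => h.1.ne rfl⟩

variable {V : Type*} [Fintype V] {G : SimpleGraph V} [DecidableRel G.Adj]

theorem degree_eq_sum (v : V) :
    (G.degree v : ℝ) = ∑ u, if G.Adj v u then (1 : ℝ) else 0 := by
  rw [← card_neighborFinset_eq_degree, neighborFinset_eq_filter]
  simp

/-- The quasirandomness estimate with explicit errors. The graph is compared with its subgraph
`H` on the vertices of degree at most `2 * c`, where `c` is the average degree. By concentration of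
the degrees, `H` loses at most `η * (n * c)` of the ordered edges, so that the path count in `H` is
still almost `n ^ 2`. -/
theorem abs_edgesBetween_sub_le {k : ℕ} (hk : 1 ≤ k)
    (hG : IsCycleFamilyFree (evenCycleLengths (k + 1) ∪ shortCycleLengths (k + 1)) G)
    {n c η ε : ℝ} (hn : n = Fintype.card V) (hcdef : c = averageDegree G) (hc : 0 < c)
    (hη : η = 8 * √(n / c ^ (k + 1) - 1 + (2 * k + 1) * k * c⁻¹)) (hη1 : η ≤ 1) (hε : 0 ≤ ε)
    (herr : 2 * (k * (2 * c) ^ k) ^ 2 + 2 * (n ^ 2 - n * ((1 - η) * c) ^ (k + 1) +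
      (2 * k + 1) * k * (n * c ^ k)) ≤ (ε * c) ^ (2 * (k + 1)))
    (S T : Finset V) :
    |(edgesBetween G S T : ℝ) - c / n * S.card * T.card| ≤ (ε + 3 * η) * (n * c) := by
  classical
  have hL1 := sum_abs_degree_sub_le hk hG (hcdef ▸ hc) rfl
  rw [← hcdef, ← hn] at hL1
  have hη0 : 0 ≤ η := by rw [hη]; positivity
  have hL1' : 4 * ∑ v, |(G.degree v : ℝ) - c| ≤ η * (n * c) := by rw [hη]; linarith
  have hn0 : 0 ≤ n := by rw [hn]; positivity
  set H := G.restrictTo {v | (G.degree v : ℝ) ≤ 2 * c} with hH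
  have hHG : H ≤ G := fun u v h => h.1
  -- the deleted edges are those meeting a vertex of large degree
  set w : V → V → ℝ := fun u v => (if G.Adj u v then 1 else 0) - (if H.Adj u v then 1 else 0)
    with hw
  have hw0 : ∀ u v, 0 ≤ w u v := by
    intro u v
    have := @hHG u v
    simp only [hw]
    split_ifs <;> simp_all
  have hw1 : ∀ u v, w u v ≤ (if 2 * c < G.degree u then if G.Adj u v then (1 : ℝ) else 0 else 0) +
      (if 2 * c < G.degree v then if G.Adj v u then (1 : ℝ) else 0 else 0) := by
    intro u v
    have hadj : H.Adj u v ↔ G.Adj u v ∧ (G.degree u : ℝ) ≤ 2 * c ∧ (G.degree v : ℝ) ≤ 2 * c :=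
      Iff.rfl
    simp only [hw, hadj, G.adj_comm v u, ← not_lt]
    split_ifs <;> simp_all
  have hwsum : ∑ u, ∑ v, w u v ≤ η * (n * c) := by
    refine le_trans ?_ hL1'
    have h1 : ∀ u, ∑ v, (if 2 * c < G.degree u then if G.Adj u v then (1 : ℝ) else 0 else 0) ≤
        2 * |(G.degree u : ℝ) - c| := by
      intro u
      by_cases h : 2 * c < G.degree u
      · simp only [h, if_true]
        rw [← degree_eq_sum]
        linarith [le_abs_self ((G.degree u : ℝ) - c)]
      · simp only [h, if_false, sum_const_zero]
        positivity
    calc ∑ u, ∑ v, w u v ≤ ∑ u, ∑ v,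
          ((if 2 * c < G.degree u then if G.Adj u v then (1 : ℝ) else 0 else 0) +
          (if 2 * c < G.degree v then if G.Adj v u then (1 : ℝ) else 0 else 0)) :=
          sum_le_sum fun u _ => sum_le_sum fun v _ => hw1 u v
      _ ≤ _ := by
          simp only [sum_add_distrib]
          rw [sum_comm (f := fun u v =>
            (if 2 * c < G.degree v then if G.Adj v u then (1 : ℝ) else 0 else 0))]
          have := sum_le_sum fun u (_ : u ∈ univ) => h1 u
          rw [← mul_sum] at this
          linarith
  have hdegH : ∀ v, (G.degree v : ℝ) - H.degree v = ∑ u, w v u := by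
    intro v
    rw [degree_eq_sum, degree_eq_sum, ← sum_sub_distrib]
  have hdegle : ∀ v, (H.degree v : ℝ) ≤ 2 * c := by
    intro v
    by_cases h : (G.degree v : ℝ) ≤ 2 * c
    · have := hdegH v
      have := sum_nonneg fun u (_ : u ∈ univ) => hw0 v u
      linarith
    · have : ∀ u, ¬ H.Adj v u := fun u hu => h hu.2.1
      rw [degree_eq_sum]
      simp [this, hc.le]
  -- the average degree of `H`
  rcases hn0.eq_or_lt with hn0' | hnpos
  · have : IsEmpty V := by
      rw [← Fintype.card_eq_zero_iff]
      exact_mod_cast (hn.symm.trans hn0'.symm)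
    have hS : S = ∅ := Subsingleton.elim _ _
    simp [edgesBetween_eq_sum, hS, ← hn0']
  have hcH : n * averageDegree H = n * c - ∑ u, ∑ v, w u v := by
    have e1 := sum_degree_eq (G := H)
    have e2 := sum_degree_eq (G := G)
    rw [← hn] at e1 e2
    rw [← hcdef] at e2
    rw [← e1, ← e2, ← sum_sub_distrib]
    refine sum_congr rfl fun v _ => ?_
    linarith [hdegH v]
  have hcHle : averageDegree H ≤ c := by
    refine le_of_mul_le_mul_left ?_ hnpos
    have := sum_nonneg fun u (_ : u ∈ univ) => sum_nonneg fun v (_ : v ∈ univ) => hw0 u v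
    linarith
  have hcHge : (1 - η) * c ≤ averageDegree H := by
    refine le_of_mul_le_mul_left ?_ hnpos
    linarith
  have hfreeH := hG.mono hHG
  have hpaths : n ^ 2 - ∑ u, ∑ v, pathIndicator H (k + 1) u v ≤
      n ^ 2 - n * ((1 - η) * c) ^ (k + 1) + (2 * k + 1) * k * (n * c ^ k) := by
    have h1 := le_sum_pathIndicator hfreeH
    rw [← hn] at h1
    have hcH0 : 0 ≤ averageDegree H := averageDegree_nonneg
    have h2 : 0 ≤ k * averageDegree H ^ k *
        ∑ v, (√(H.degree v : ℝ) - √(averageDegree H)) ^ 2 :=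
      mul_nonneg (by positivity) (sum_nonneg fun v _ => sq_nonneg _)
    have h3 : n * ((1 - η) * c) ^ (k + 1) ≤ n * averageDegree H ^ (k + 1) := by
      have : 0 ≤ (1 - η) * c := mul_nonneg (by linarith) hc.le
      gcongr
    have h4 : (2 * k + 1) * k * (n * averageDegree H ^ k) ≤
        (2 * k + 1) * k * (n * c ^ k) := by gcongr
    linarith
  have hmain := edgesBetween_sub_pow_le hfreeH hdegle (hn ▸ hpaths) S T
  rw [← hn] at hmain
  have hmain' : |(edgesBetween H S T : ℝ) - S.card / n * ∑ t ∈ T, (H.degree t : ℝ)| ≤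
      ε * (n * c) := by
    have hk0 : 2 * (k + 1) ≠ 0 := by omega
    refine le_of_pow_le_pow_left₀ hk0 (by positivity) ?_
    rw [pow_mul, sq_abs]
    refine (hmain.trans (mul_le_mul_of_nonneg_right herr (by positivity))).trans (le_of_eq ?_)
    rw [← pow_mul, ← mul_pow]
    ring
  have hedges : |(edgesBetween G S T : ℝ) - edgesBetween H S T| ≤ η * (n * c) := by
    have e : (edgesBetween G S T : ℝ) - edgesBetween H S T = ∑ t ∈ T, ∑ s ∈ S, w t s := by
      rw [edgesBetween_eq_sum, edgesBetween_eq_sum, ← sum_sub_distrib]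
      exact sum_congr rfl fun t _ => sum_sub_distrib _ _ |>.symm
    rw [e, abs_of_nonneg (sum_nonneg fun t _ => sum_nonneg fun s _ => hw0 t s)]
    refine le_trans ?_ hwsum
    refine (sum_le_sum fun t _ => sum_le_univ_sum_of_nonneg fun s => hw0 t s).trans ?_
    exact sum_le_univ_sum_of_nonneg fun t => sum_nonneg fun s _ => hw0 t s
  have hdegT : |∑ t ∈ T, (H.degree t : ℝ) - c * T.card| ≤ 2 * (η * (n * c)) := by
    have e : ∑ t ∈ T, (H.degree t : ℝ) - c * T.card =
        ∑ t ∈ T, ((G.degree t : ℝ) - c) - ∑ t ∈ T, ∑ u, w t u := by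
      rw [← sum_congr rfl fun t _ => hdegH t, sum_sub_distrib, sum_sub_distrib, sum_const,
        nsmul_eq_mul]
      ring
    have e1 : |∑ t ∈ T, ((G.degree t : ℝ) - c)| ≤ ∑ v, |(G.degree v : ℝ) - c| :=
      (abs_sum_le_sum_abs _ _).trans (sum_le_univ_sum_of_nonneg fun v => abs_nonneg _)
    have e2 : |∑ t ∈ T, ∑ u, w t u| ≤ η * (n * c) := by
      rw [abs_of_nonneg (sum_nonneg fun t _ => sum_nonneg fun s _ => hw0 t s)]
      exact (sum_le_univ_sum_of_nonneg fun t => sum_nonneg fun s _ => hw0 t s).trans hwsum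
    have e3 : 0 ≤ ∑ v, |(G.degree v : ℝ) - c| := sum_nonneg fun v _ => abs_nonneg _
    rw [e]
    refine (abs_sub _ _).trans ?_
    linarith
  have hSn : (S.card : ℝ) / n ≤ 1 := by
    rw [div_le_one hnpos, hn]
    exact_mod_cast card_le_univ S
  have hdegT' : |S.card / n * (∑ t ∈ T, (H.degree t : ℝ) - c * T.card)| ≤ 2 * (η * (n * c)) := by
    rw [abs_mul, abs_of_nonneg (by positivity : 0 ≤ (S.card : ℝ) / n)]
    exact (mul_le_of_le_one_left (abs_nonneg _) hSn).trans hdegT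
  have hsum : (edgesBetween G S T : ℝ) - c / n * S.card * T.card =
      ((edgesBetween G S T : ℝ) - edgesBetween H S T) +
      (((edgesBetween H S T : ℝ) - S.card / n * ∑ t ∈ T, (H.degree t : ℝ)) +
      S.card / n * (∑ t ∈ T, (H.degree t : ℝ) - c * T.card)) := by ring
  rw [hsum]
  refine (abs_add_le _ _).trans ?_
  have := abs_add_le ((edgesBetween H S T : ℝ) - S.card / n * ∑ t ∈ T, (H.degree t : ℝ))
    (S.card / n * (∑ t ∈ T, (H.degree t : ℝ) - c * T.card))
  linarith

end Capping

/-! ### Passing to the limit -/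

section Limit

open Filter Topology

/-- The hypotheses of `abs_edgesBetween_sub_le`, written in terms of `ρ = c ^ (k + 1) / n` and
`t = 1 / c`, hold near `(ρ, t) = (1, 0)`, where all error terms vanish. -/
theorem eventually_error_le (k : ℕ) {ε : ℝ} (hε : 0 < ε) :
    ∀ᶠ p : ℝ × ℝ in 𝓝 (1, 0),
      8 * √(p.1⁻¹ - 1 + (2 * k + 1) * k * p.2) < ε ∧
      2 * (k * 2 ^ k * (p.1 * p.2)) ^ 2 + 2 * (1 -
        (1 - 8 * √(p.1⁻¹ - 1 + (2 * k + 1) * k * p.2)) ^ (k + 1) * p.1 +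
        (2 * k + 1) * k * (p.1 * p.2)) < ε ^ (2 * (k + 1)) * p.1 ^ 2 := by
  have h1 : ContinuousAt (fun p : ℝ × ℝ => 8 * √(p.1⁻¹ - 1 + (2 * k + 1) * k * p.2)) (1, 0) := by
    have : ContinuousAt (fun p : ℝ × ℝ => p.1⁻¹) (1, 0) :=
      continuousAt_fst.inv₀ one_ne_zero
    fun_prop
  have h2 : ContinuousAt (fun p : ℝ × ℝ => 2 * (k * 2 ^ k * (p.1 * p.2)) ^ 2 + 2 * (1 -
        (1 - 8 * √(p.1⁻¹ - 1 + (2 * k + 1) * k * p.2)) ^ (k + 1) * p.1 +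
        (2 * k + 1) * k * (p.1 * p.2))) (1, 0) := by fun_prop
  have h3 : ContinuousAt (fun p : ℝ × ℝ => ε ^ (2 * (k + 1)) * p.1 ^ 2) (1, 0) := by fun_prop
  refine (h1.eventually_lt continuousAt_const (by simpa using hε)).and
    (h2.eventually_lt h3 ?_)
  simp only [inv_one, sub_self, mul_zero, add_zero, Real.sqrt_zero, sub_zero, one_pow, mul_one]
  have : 0 < ε ^ (2 * (k + 1)) := by positivity
  simpa using this

end Limit

theorem mainTheorem9 (k : ℕ) (hk : 2 ≤ k)
    {V : ℕ → Type*} [∀ i, Fintype (V i)]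
    (G : ∀ i, SimpleGraph (V i)) [∀ i, DecidableRel (G i).Adj]
    (hfree : ∀ i, IsCycleFamilyFree (evenCycleLengths k ∪ shortCycleLengths k) (G i))
    (hcard : Filter.Tendsto (fun i => Fintype.card (V i)) Filter.atTop Filter.atTop)
    (hdeg : Asymptotics.IsEquivalent Filter.atTop
      (fun i => averageDegree (G i))
      (fun i => (Fintype.card (V i) : ℝ) ^ ((1 : ℝ) / (k : ℝ)))) :
    ∃ r : ℕ → ℝ,
      Asymptotics.IsLittleO Filter.atTop r
        (fun i => (Fintype.card (V i) : ℝ) ^ (1 + (1 : ℝ) / (k : ℝ))) ∧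
      ∀ (i : ℕ) (S T : Finset (V i)),
        |(edgesBetween (G i) S T : ℝ) -
          averageDegree (G i) / (Fintype.card (V i) : ℝ) * (S.card : ℝ) * (T.card : ℝ)| ≤ r i := by
  obtain ⟨m, rfl⟩ : ∃ m, k = m + 1 := ⟨k - 1, by omega⟩
  have hm : 1 ≤ m := by omega
  set n : ℕ → ℝ := fun i => (Fintype.card (V i) : ℝ) with hn
  set c : ℕ → ℝ := fun i => averageDegree (G i) with hc
  set b : ℕ → ℝ := fun i => n i ^ ((1 : ℝ) / ((m + 1 : ℕ) : ℝ)) with hb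
  have hntop : Filter.Tendsto n Filter.atTop Filter.atTop :=
    tendsto_natCast_atTop_atTop.comp hcard
  have hnpos : ∀ᶠ i in Filter.atTop, 0 < n i := hntop.eventually_gt_atTop 0
  have hbtop : Filter.Tendsto b Filter.atTop Filter.atTop :=
    (tendsto_rpow_atTop (by positivity)).comp hntop
  have hbpow : ∀ i, b i ^ (m + 1) = n i := fun i => by
    simp only [hb]
    rw [one_div, Real.rpow_inv_natCast_pow (Nat.cast_nonneg _) (Nat.succ_ne_zero m)]
  have hctop : Filter.Tendsto c Filter.atTop Filter.atTop := hdeg.symm.tendsto_atTop hbtop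
  have hcpos : ∀ᶠ i in Filter.atTop, 0 < c i := hctop.eventually_gt_atTop 0
  have hcb : Filter.Tendsto (fun i => c i / b i) Filter.atTop (nhds 1) :=
    (Asymptotics.isEquivalent_iff_tendsto_one
      ((hbtop.eventually_gt_atTop 0).mono fun i h => h.ne')).1 hdeg
  have hρ : Filter.Tendsto (fun i => c i ^ (m + 1) / n i) Filter.atTop (nhds 1) := by
    have := hcb.pow (m + 1)
    simpa only [div_pow, hbpow, one_pow] using this
  have hpair : Filter.Tendsto (fun i => (c i ^ (m + 1) / n i, (c i)⁻¹)) Filter.atTop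
      (nhds ((1 : ℝ), (0 : ℝ))) := hρ.prodMk_nhds (tendsto_inv_atTop_zero.comp hctop)
  refine ⟨fun i => Finset.univ.sup' Finset.univ_nonempty
    fun ST : Finset (V i) × Finset (V i) =>
      |(edgesBetween (G i) ST.1 ST.2 : ℝ) - c i / n i * ST.1.card * ST.2.card|, ?_, ?_⟩
  · rw [Asymptotics.isLittleO_iff]
    intro δ hδ
    -- the error `(ε + 3 * η) * (n * c)` with `η < ε` and `c ≤ 2 * b` is at most `8 * ε * (n * b)`
    set ε : ℝ := min (δ / 8) 1 with hεdef
    have hε : 0 < ε := by positivity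
    have hε1 : ε ≤ 1 := min_le_right _ _
    have hεδ : ε ≤ δ / 8 := min_le_left _ _
    filter_upwards [hpair.eventually (eventually_error_le m hε), hnpos, hcpos,
      hcb.eventually_lt_const (by norm_num : (1 : ℝ) < 2), hbtop.eventually_gt_atTop 0]
      with i hi hni hci hcbi hbi
    obtain ⟨h1, h2⟩ := hi
    simp only [inv_div] at h1 h2
    set η : ℝ := 8 * √(n i / c i ^ (m + 1) - 1 + (2 * m + 1) * m * (c i)⁻¹) with hη
    have herr : 2 * (m * (2 * c i) ^ m) ^ 2 + 2 * (n i ^ 2 - n i * ((1 - η) * c i) ^ (m + 1) +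
        (2 * m + 1) * m * (n i * c i ^ m)) ≤ (ε * c i) ^ (2 * (m + 1)) := by
      have h3 := mul_le_mul_of_nonneg_right h2.le (sq_nonneg (n i))
      have ht : c i ^ (m + 1) / n i * (c i)⁻¹ = c i ^ m / n i := by
        rw [pow_succ]; field_simp
      rw [ht] at h3
      have e1 : (2 * (m * 2 ^ m * (c i ^ m / n i)) ^ 2 + 2 * (1 -
          (1 - η) ^ (m + 1) * (c i ^ (m + 1) / n i) + (2 * m + 1) * m * (c i ^ m / n i))) *
            n i ^ 2 = 2 * (m * (2 * c i) ^ m) ^ 2 + 2 * (n i ^ 2 -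
              n i * ((1 - η) * c i) ^ (m + 1) + (2 * m + 1) * m * (n i * c i ^ m)) := by
        rw [mul_pow 2, mul_pow (1 - η)]
        field_simp
      have e2 : ε ^ (2 * (m + 1)) * (c i ^ (m + 1) / n i) ^ 2 * n i ^ 2 =
          (ε * c i) ^ (2 * (m + 1)) := by
        rw [mul_pow, div_pow, mul_assoc, div_mul_cancel₀ _ (by positivity), ← pow_mul,
          mul_comm (m + 1) 2]
      rw [← e1, ← e2]
      exact h3
    have hbound := abs_edgesBetween_sub_le hm (hfree i) (n := n i) (c := c i) rfl rfl hci hη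
      (h1.le.trans hε1) hε.le herr
    have hpow : n i ^ (1 + (1 : ℝ) / ((m + 1 : ℕ) : ℝ)) = n i * b i := by
      rw [Real.rpow_add hni, Real.rpow_one]
    have hcle : c i ≤ 2 * b i := by
      rw [div_lt_iff₀ hbi] at hcbi
      exact hcbi.le
    change ‖_‖ ≤ δ * ‖n i ^ (1 + (1 : ℝ) / ((m + 1 : ℕ) : ℝ))‖
    rw [hpow, Real.norm_of_nonneg (by positivity : 0 ≤ n i * b i), Real.norm_of_nonneg]
    · refine Finset.sup'_le _ _ fun ST _ => (hbound ST.1 ST.2).trans ?_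
      calc (ε + 3 * η) * (n i * c i) ≤ (ε + 3 * ε) * (n i * (2 * b i)) := by gcongr
        _ = 8 * ε * (n i * b i) := by ring
        _ ≤ δ * (n i * b i) := by
            refine mul_le_mul_of_nonneg_right (by linarith) (by positivity)
    · exact (abs_nonneg _).trans (Finset.le_sup' (fun ST : Finset (V i) × Finset (V i) =>
        |(edgesBetween (G i) ST.1 ST.2 : ℝ) - c i / n i * ST.1.card * ST.2.card|)
          (Finset.mem_univ (∅, ∅)))
  · intro i S T
    exact Finset.le_sup' (fun ST : Finset (V i) × Finset (V i) =>
      |(edgesBetween (G i) ST.1 ST.2 : ℝ) - c i / n i * ST.1.card * ST.2.card|)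
        (Finset.mem_univ (S, T))
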